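/- Let $(\Omega,\mathcal A,P)$ be a probability space. For a real random variable $X$ put $F_X(x)=P(X\le x)$ and $F_X^{-1}(u)=\inf\{x\in\mathbb R: F_X(x)\ge u\}\in[-\infty,\infty]$, $u\in[0,1]$. Let $g:[0,1]\to[0,1]$ be a distortion function, that is, $g$ is increasing (in the wide sense) and right-continuous with $\lim_{u\nearrow 1}g(u)=g(1)=1$; let $\mu_g$ be the Borel probability measure on $[0,1]$ with $\mu_g([0,u])=g(u)$ for $u\in[0,1]$, and write $\int_0^1 f\,\mathrm dg=\int_{[0,1]}f\,\mathrm d\mu_g$. Let $\phi:[0,\infty)\to[0,\infty)$ be a normalized Young function, that is, $\phi$ is convex, $\phi(0)=0$, $\lim_{t\to\infty}\phi(t)=\infty$ and $\phi(1)=1$; put $\phi(\infty)=\infty$. Let $L_g^\phi$ be the set of all real random variables $X$ on $\Omega$ such that $\int_0^1\phi\big(|F_X^{-1}(1-u)|/a\big)\,\mathrm dg(u)<\infty$ for some $a>0$. For $\alpha<1$ and $Y\in L_g^\phi$ with $Y\ge 0$ almost surely put \[ \pi_{g,\phi,\alpha}(Y)=\inf\Big\{a>0:\int_0^1\phi\Big(\frac{F_Y^{-1}(1-u)}{a}\Big)\,\mathrm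 dg(u)\le 1-\alpha\Big\}, \] and for $0\le\alpha<1$ and $X\in L_g^\phi$ put \[ \rho_{g,\phi,\alpha}(X)=\inf_{x\in\mathbb R}\big(\pi_{g,\phi,\alpha}((X-x)^+)+x\big). \] Let $0<\alpha<1$ and $X\in L_g^\phi$. (a) The infimum defining $\rho_{g,\phi,\alpha}(X)$ is attained, that is, \[ \rho_{g,\phi,\alpha}(X)=\min_{x\in\mathbb R}\big(\pi_{g,\phi,\alpha}((X-x)^+)+x\big). \] (b) Suppose that $g$ is continuous with $g(0)=0$ and $g>0$ on $(0,1]$, that $\phi$ is strictly convex and satisfies the $\Delta_2$-condition (there are $s\ge 0$ and $K>0$ with $\phi(2t)\le K\phi(t)$ for all $t\ge s$), and that $P(X=\operatorname{ess\,sup}X)=0$, where $\operatorname{ess\,sup}X\in(-\infty,\infty]$. Then there is a unique $x\in\mathbb R$ such that $\rho_{g,\phi,\alpha}(X)=\pi_{g,\phi,\alpha}((X-x)^+)+x$. -/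

import Mathlib

open MeasureTheory Filter Topology Set
open scoped ENNReal

noncomputable section

/-- A distortion function `g : [0,1] → [0,1]`: increasing, right-continuous, and
`lim_{u ↗ 1} g u = g 1 = 1`. It is coded by a function on `ℝ` of which only the values on
`[0,1]` matter. -/
structure DistortionFunction where
  toFun : ℝ → ℝ
  mapsTo' : MapsTo toFun (Icc 0 1) (Icc 0 1)
  mono' : MonotoneOn toFun (Icc 0 1)
  right_continuous' : ∀ u ∈ Ico (0 : ℝ) 1, ContinuousWithinAt toFun (Ici u) u
  tendsto_one' : Tendsto toFun (𝓝[<] 1) (𝓝 1)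
  map_one' : toFun 1 = 1

instance : CoeFun DistortionFunction (fun _ => ℝ → ℝ) := ⟨DistortionFunction.toFun⟩

/-- The extension of `g` to `ℝ` by `0` on `(-∞,0)` and by `1` on `(1,∞)`. -/
def DistortionFunction.stieltjes (g : DistortionFunction) : StieltjesFunction ℝ where
  toFun u := if u < 0 then 0 else g (min u 1)
  mono' := by
    intro a b hab
    have h0 : ∀ u : ℝ, 0 ≤ u → min u 1 ∈ Icc (0 : ℝ) 1 :=
      fun u hu => ⟨le_min hu zero_le_one, min_le_right _ _⟩
    dsimp only
    split_ifs with ha hb hb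
    · exact le_rfl
    · exact (g.mapsTo' (h0 b (not_lt.1 hb))).1
    · linarith
    · exact g.mono' (h0 a (not_lt.1 ha)) (h0 b (not_lt.1 hb)) (min_le_min_right 1 hab)
  right_continuous' := by
    intro x
    rcases lt_or_ge x 0 with hx | hx
    · refine ContinuousAt.continuousWithinAt ?_
      refine (continuousAt_const (y := (0 : ℝ))).congr ?_
      filter_upwards [Iio_mem_nhds hx] with y hy
      exact (if_pos (mem_Iio.1 hy)).symm
    · rcases lt_or_ge x 1 with hx1 | hx1
      · refine (g.right_continuous' x ⟨hx, hx1⟩).congr_of_eventuallyEq ?_ ?_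
        · filter_upwards [self_mem_nhdsWithin, mem_nhdsWithin_of_mem_nhds (Iio_mem_nhds hx1)]
            with y hy hy1
          rw [if_neg (not_lt.2 (hx.trans hy)), min_eq_left (le_of_lt hy1)]
        · rw [if_neg (not_lt.2 hx), min_eq_left hx1.le]
      · refine (continuousWithinAt_const (b := g 1)).congr ?_ ?_
        · intro y hy
          rw [if_neg (not_lt.2 (hx.trans hy)), min_eq_right (hx1.trans hy)]
        · rw [if_neg (not_lt.2 hx), min_eq_right hx1]

/-- The Borel probability measure `μ_g` with `μ_g [0,u] = g u` for `u ∈ [0,1]` (in particular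
with an atom of mass `g 0` at `0`); `∫ f dg` is the Lebesgue integral with respect to `μ_g`. -/
def DistortionFunction.measure (g : DistortionFunction) : Measure ℝ := g.stieltjes.measure

theorem DistortionFunction.measure_Icc (g : DistortionFunction) {u : ℝ} (hu : u ∈ Icc (0 : ℝ) 1) :
    g.measure (Icc 0 u) = ENNReal.ofReal (g u) := by
  have hl : Function.leftLim g.stieltjes 0 = 0 := by
    refine leftLim_eq_of_tendsto ?_
    refine tendsto_const_nhds.congr' ?_
    filter_upwards [self_mem_nhdsWithin] with y hy
    exact (if_pos hy).symm
  have hv : g.stieltjes u = g u := by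
    change (if u < 0 then 0 else g (min u 1)) = g u
    rw [if_neg (not_lt.2 hu.1), min_eq_left hu.2]
  rw [DistortionFunction.measure, StieltjesFunction.measure_Icc, hl, hv, sub_zero]

theorem DistortionFunction.measure_univ (g : DistortionFunction) : g.measure univ = 1 := by
  have h0 : Tendsto g.stieltjes atBot (𝓝 0) := by
    refine tendsto_const_nhds.congr' ?_
    filter_upwards [Iio_mem_atBot (0 : ℝ)] with y hy
    exact (if_pos hy).symm
  have h1 : Tendsto g.stieltjes atTop (𝓝 1) := by
    refine tendsto_const_nhds.congr' ?_
    filter_upwards [Ici_mem_atTop (1 : ℝ)] with y hy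
    have hy' : (1 : ℝ) ≤ y := hy
    change 1 = (if y < 0 then 0 else g (min y 1))
    rw [if_neg (by linarith), min_eq_right hy', g.map_one']
  rw [DistortionFunction.measure, StieltjesFunction.measure_univ _ h0 h1]
  simp

/-- A Young function `φ : [0,∞) → [0,∞)`: convex, `φ 0 = 0`, `φ t → ∞` as `t → ∞`. Only the
values on `[0,∞)` matter. -/
structure IsYoungFunction (φ : ℝ → ℝ) : Prop where
  convexOn : ConvexOn ℝ (Ici 0) φ
  nonneg : ∀ t, 0 ≤ t → 0 ≤ φ t
  map_zero : φ 0 = 0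
  tendsto_atTop : Tendsto φ atTop atTop

/-- The `Δ₂`-condition: `φ (2 t) ≤ K φ t` for all large `t`. -/
def SatisfiesDeltaTwo (φ : ℝ → ℝ) : Prop :=
  ∃ s K : ℝ, 0 ≤ s ∧ 0 < K ∧ ∀ t, s ≤ t → φ (2 * t) ≤ K * φ t

/-- The extension of a Young function to `[0,∞]` by `φ ∞ = ∞`. -/
def youngExt (φ : ℝ → ℝ) (t : ℝ≥0∞) : ℝ≥0∞ :=
  if t = ⊤ then ⊤ else ENNReal.ofReal (φ t.toReal)

variable {Ω : Type*} [MeasurableSpace Ω]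

/-- The quantile function `F_X⁻¹ u = inf {x ∈ ℝ : u ≤ F_X x}`, where `F_X x = P (X ≤ x)`,
with values in `[-∞,∞]`. -/
def quantile (P : Measure Ω) (X : Ω → ℝ) (u : ℝ) : EReal :=
  sInf ((fun x : ℝ => (x : EReal)) '' {x : ℝ | u ≤ P.real {ω | X ω ≤ x}})

/-- The integral `∫₀¹ φ (|F_X⁻¹ (1 - u)| / a) dg(u)` over `[0,1]`, with values in `[0,∞]`.
If `X ≥ 0` almost surely, the quantiles of positive order are positive and `μ_g {1} = 0`, so
that the absolute value has no effect. -/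
def orliczLorentzModular (P : Measure Ω) (g : DistortionFunction) (φ : ℝ → ℝ)
    (X : Ω → ℝ) (a : ℝ) : ℝ≥0∞ :=
  ∫⁻ u in Icc (0 : ℝ) 1, youngExt φ ((quantile P X (1 - u)).abs / ENNReal.ofReal a) ∂g.measure

/-- The space `L_g^φ` of the risks `X` such that `∫₀¹ φ (|F_X⁻¹ (1 - u)| / a) dg(u) < ∞` for
some `a > 0`. -/
def orliczLorentzSpace (P : Measure Ω) (g : DistortionFunction) (φ : ℝ → ℝ) : Set (Ω → ℝ) :=
  {X | Measurable X ∧ ∃ a : ℝ, 0 < a ∧ orliczLorentzModular P g φ X a < ⊤}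

/-- The Orlicz-Lorentz premium `π_{g,φ,α}`, to be applied to positive risks in `L_g^φ`. -/
def orliczLorentzPremium (P : Measure Ω) (g : DistortionFunction) (φ : ℝ → ℝ) (α : ℝ)
    (X : Ω → ℝ) : ℝ :=
  sInf {a : ℝ | 0 < a ∧ orliczLorentzModular P g φ X a ≤ ENNReal.ofReal (1 - α)}

/-- The function `x ↦ π_{g,φ,α} ((X - x)⁺) + x`. -/
def shiftedPremium (P : Measure Ω) (g : DistortionFunction) (φ : ℝ → ℝ) (α : ℝ)
    (X : Ω → ℝ) (x : ℝ) : ℝ :=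
  orliczLorentzPremium P g φ α (fun ω => max (X ω - x) 0) + x

/-- The distortion Haezendonck-Goovaerts risk measure
`ρ_{g,φ,α} X = inf_{x ∈ ℝ} (π_{g,φ,α} ((X - x)⁺) + x)`. -/
def distortionHGRisk (P : Measure Ω) (g : DistortionFunction) (φ : ℝ → ℝ) (α : ℝ)
    (X : Ω → ℝ) : ℝ :=
  ⨅ x : ℝ, shiftedPremium P g φ α X x

/-- The essential supremum of a real random variable, with values in `[-∞,∞]`. -/
def essSupReal (P : Measure Ω) (X : Ω → ℝ) : EReal :=
  essSup (fun ω => (X ω : EReal)) P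

end

/-! ### Pointwise convexity inequalities for Young functions. -/

section YoungFunction

variable {φ : ℝ → ℝ}

/-! Put `Z u = F_X⁻¹ (1 - u)` on `[0,1]` with the measure `μ_g`. Quantiles of positive order commute
with `(· - x)⁺`, so the premium of `(X - x)⁺` is the Luxemburg norm `N x` of `(Z - x)⁺` at level `β
= 1 - α`, and both claims concern the function `x ↦ N x + x` on a probability space.

Existence: `N` is finite and convex, hence continuous, so coercivity suffices. At `+∞` it holds
since `N ≥ 0`. At `-∞` it comes from `α > 0`: as `β < 1 = φ 1`, some `c < 1` has `φ c > β`, which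
makes `N x` grow at least like `-x / c`, faster than `-x` (`tendsto_shiftNorm_add_cocompact`).

Uniqueness: between two minimizers `x < y` the midpoint `w` is also a minimizer, and it lies below
the essential supremum `M`, so `N x` and `N w` are positive. By `Δ₂` the modulars at these norms are
at most `β`. Strict convexity then pushes the modular at the midpoint of `x` and `w` below `β`, and
by `Δ₂` the norm there drops strictly, contradicting minimality. The exception, `(Z - x)⁺ / N x = (Z
- w)⁺ / N w` almost everywhere, would make `Z` constant on `{Z > w}`; this is impossible because `Z
< M` almost everywhere while `Z` exceeds every real below `M` with positive measure
(`unique_isMin_shiftNorm_add`). -/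

theorem IsYoungFunction.map_mul_le (hφ : IsYoungFunction φ) {c t : ℝ} (hc : 0 ≤ c) (hc1 : c ≤ 1)
    (ht : 0 ≤ t) : φ (c * t) ≤ c * φ t := by
  have := hφ.convexOn.2 (mem_Ici.2 ht) (mem_Ici.2 le_rfl) hc (sub_nonneg.2 hc1) (by ring)
  simpa [hφ.map_zero] using this

theorem IsYoungFunction.monotoneOn (hφ : IsYoungFunction φ) : MonotoneOn φ (Ici 0) := by
  intro s hs t ht hst
  rw [mem_Ici] at hs ht
  rcases hs.eq_or_lt with rfl | hs'
  · rw [hφ.map_zero]; exact hφ.nonneg t ht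
  have ht' : 0 < t := hs'.trans_le hst
  have h1 : s / t ≤ 1 := (div_le_one ht').2 hst
  have h := hφ.map_mul_le (div_nonneg hs ht) h1 ht
  rw [div_mul_cancel₀ _ ht'.ne'] at h
  exact h.trans (mul_le_of_le_one_left (hφ.nonneg t ht) h1)

theorem IsYoungFunction.measurable_comp (hφ : IsYoungFunction φ) {S : Type*} [MeasurableSpace S]
    {W : S → ℝ} (hW : Measurable W) (hW0 : ∀ s, 0 ≤ W s) : Measurable fun s => φ (W s) := by
  -- Only the values of `φ` on `[0,∞)` are controlled, so measurability is taken from a monotone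
  -- modification on `ℝ`.
  have hm : Monotone fun t : ℝ => φ (max t 0) := fun a b hab =>
    hφ.monotoneOn (mem_Ici.2 (le_max_right _ _)) (mem_Ici.2 (le_max_right _ _))
      (max_le_max_right 0 hab)
  simpa [Function.comp_def, max_eq_left (hW0 _)] using hm.measurable.comp hW

theorem IsYoungFunction.map_one_add_mul_le (hφ : IsYoungFunction φ) {t p : ℝ} (ht : 0 ≤ t)
    (ht1 : t ≤ 1) (hp : 0 ≤ p) : φ ((1 + t) * p) ≤ φ p + t * φ (2 * p) := by
  have := hφ.convexOn.2 (mem_Ici.2 hp) (mem_Ici.2 (by positivity : 0 ≤ 2 * p)) (sub_nonneg.2 ht1)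
    ht (by ring)
  simp only [smul_eq_mul] at this
  rw [show (1 - t) * p + t * (2 * p) = (1 + t) * p by ring] at this
  nlinarith [hφ.nonneg p hp]

/-- Near `1` a Young function with `φ 1 = 1` takes values close to `1`. -/
theorem IsYoungFunction.exists_lt_one (hφ : IsYoungFunction φ) (hφ1 : φ 1 = 1) {β : ℝ}
    (hβ : β < 1) : ∃ c, 0 < c ∧ c < 1 ∧ β < φ c := by
  have hc : ContinuousOn φ (Ioi 0) := by
    have := hφ.convexOn.continuousOn_interior
    rwa [interior_Ici] at this
  have h1 : ContinuousAt φ 1 := hc.continuousAt (Ioi_mem_nhds one_pos)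
  have h2 : ∀ᶠ c in 𝓝 (1 : ℝ), β < φ c := h1.eventually (lt_mem_nhds (by rw [hφ1]; exact hβ))
  have h3 : ∀ᶠ c in 𝓝[<] (1 : ℝ), (β < φ c ∧ 0 < c) ∧ c < 1 :=
    ((h2.and (lt_mem_nhds one_pos)).filter_mono nhdsWithin_le_nhds).and self_mem_nhdsWithin
  obtain ⟨c, ⟨h, h0⟩, hc1⟩ := h3.exists
  exact ⟨c, h0, hc1, h⟩

/-- The weights `l a / D` and `m b / D`, with `D = l a + m b`, sum to `1` and cancel the inner
denominators; what remains is convexity of `x ↦ (z - x)⁺`. This joint convexity in shift and scale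
is what makes the norm convex. -/
theorem posPart_sub_div_le {a b l m x y z : ℝ} (ha : 0 < a) (hb : 0 < b) (hl : 0 ≤ l) (hm : 0 ≤ m)
    (hlm : l + m = 1) :
    max (z - (l * x + m * y)) 0 / (l * a + m * b) ≤
      l * a / (l * a + m * b) * (max (z - x) 0 / a) +
        m * b / (l * a + m * b) * (max (z - y) 0 / b) := by
  have hD : 0 < l * a + m * b := by
    rcases hl.eq_or_lt with rfl | hl'
    · have : m = 1 := by linarith
      subst this; simpa using hb
    · positivity
  have e : l * a / (l * a + m * b) * (max (z - x) 0 / a) +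
        m * b / (l * a + m * b) * (max (z - y) 0 / b) =
      (l * max (z - x) 0 + m * max (z - y) 0) / (l * a + m * b) := by
    field_simp
  rw [e]
  gcongr
  have hz : z = l * z + m * z := by rw [← add_mul, hlm, one_mul]
  refine max_le ?_ (by positivity)
  have h1 := mul_le_mul_of_nonneg_left (le_max_left (z - x) 0) hl
  have h2 := mul_le_mul_of_nonneg_left (le_max_left (z - y) 0) hm
  nlinarith

theorem IsYoungFunction.map_posPart_le (hφ : IsYoungFunction φ) {a b l m x y z : ℝ} (ha : 0 < a)
    (hb : 0 < b) (hl : 0 ≤ l) (hm : 0 ≤ m) (hlm : l + m = 1) :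
    φ (max (z - (l * x + m * y)) 0 / (l * a + m * b)) ≤
      l * a / (l * a + m * b) * φ (max (z - x) 0 / a) +
        m * b / (l * a + m * b) * φ (max (z - y) 0 / b) := by
  have hD : 0 < l * a + m * b := by
    rcases hl.eq_or_lt with rfl | hl'
    · have : m = 1 := by linarith
      subst this; simpa using hb
    · positivity
  refine (hφ.monotoneOn ?_ ?_ (posPart_sub_div_le ha hb hl hm hlm)).trans ?_
  · rw [mem_Ici]; positivity
  · rw [mem_Ici]; positivity
  · refine hφ.convexOn.2 ?_ ?_ (by positivity) (by positivity) (by field_simp)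
    · rw [mem_Ici]; positivity
    · rw [mem_Ici]; positivity

theorem IsYoungFunction.map_posPart_lt (hφ : IsYoungFunction φ) (hs : StrictConvexOn ℝ (Ici 0) φ)
    {a b l m x y z : ℝ} (ha : 0 < a) (hb : 0 < b) (hl : 0 < l) (hm : 0 < m) (hlm : l + m = 1)
    (hne : max (z - x) 0 / a ≠ max (z - y) 0 / b) :
    φ (max (z - (l * x + m * y)) 0 / (l * a + m * b)) <
      l * a / (l * a + m * b) * φ (max (z - x) 0 / a) +
        m * b / (l * a + m * b) * φ (max (z - y) 0 / b) := by
  refine (hφ.monotoneOn ?_ ?_ (posPart_sub_div_le ha hb hl.le hm.le hlm)).trans_lt ?_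
  · rw [mem_Ici]; positivity
  · rw [mem_Ici]; positivity
  · refine hs.2 ?_ ?_ hne (by positivity) (by positivity) (by field_simp)
    · rw [mem_Ici]; positivity
    · rw [mem_Ici]; positivity

end YoungFunction

/-! ### The shifted Luxemburg norm: convexity, coercivity, existence of a minimizer. -/

noncomputable section

variable {S : Type*} [MeasurableSpace S]

/-- The modular `∫ φ ((Z - x)⁺ / a) dν`. -/
def shiftModular (ν : Measure S) (φ : ℝ → ℝ) (Z : S → ℝ) (x a : ℝ) : ℝ≥0∞ :=
  ∫⁻ s, ENNReal.ofReal (φ (max (Z s - x) 0 / a)) ∂ν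

/-- The Luxemburg-type norm `inf {a > 0 : ∫ φ ((Z - x)⁺ / a) dν ≤ β}`. -/
def shiftNorm (ν : Measure S) (φ : ℝ → ℝ) (Z : S → ℝ) (β x : ℝ) : ℝ :=
  sInf {a : ℝ | 0 < a ∧ shiftModular ν φ Z x a ≤ ENNReal.ofReal β}

variable {ν : Measure S} {φ : ℝ → ℝ} {Z : S → ℝ} {β x y a b l m : ℝ}

theorem IsYoungFunction.measurable_posPart (hφ : IsYoungFunction φ) (hZ : Measurable Z)
    (ha : 0 ≤ a) : Measurable fun s => φ (max (Z s - x) 0 / a) :=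
  hφ.measurable_comp (((hZ.sub_const x).max measurable_const).div_const a)
    fun _ => div_nonneg (le_max_right _ _) ha

theorem shiftModular_anti (hφ : IsYoungFunction φ) (ha : 0 < a) (hab : a ≤ b) :
    shiftModular ν φ Z x b ≤ shiftModular ν φ Z x a := by
  refine lintegral_mono fun s => ENNReal.ofReal_le_ofReal ?_
  have hb := ha.trans_le hab
  have h0 := le_max_right (Z s - x) 0
  refine hφ.monotoneOn (mem_Ici.2 (by positivity)) (mem_Ici.2 (by positivity)) ?_
  gcongr

theorem shiftModular_convex_le (hφ : IsYoungFunction φ) (hZ : Measurable Z) (ha : 0 < a)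
    (hb : 0 < b) (hl : 0 ≤ l) (hm : 0 ≤ m) (hlm : l + m = 1) :
    shiftModular ν φ Z (l * x + m * y) (l * a + m * b) ≤
      ENNReal.ofReal (l * a / (l * a + m * b)) * shiftModular ν φ Z x a +
        ENNReal.ofReal (m * b / (l * a + m * b)) * shiftModular ν φ Z y b := by
  unfold shiftModular
  rw [← lintegral_const_mul _ (hφ.measurable_posPart hZ ha.le).ennreal_ofReal,
    ← lintegral_const_mul _ (hφ.measurable_posPart hZ hb.le).ennreal_ofReal,
    ← lintegral_add_left ((hφ.measurable_posPart hZ ha.le).ennreal_ofReal.const_mul _)]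
  refine lintegral_mono fun s => ?_
  have h1 : 0 ≤ φ (max (Z s - x) 0 / a) := hφ.nonneg _ (by positivity)
  have h2 : 0 ≤ φ (max (Z s - y) 0 / b) := hφ.nonneg _ (by positivity)
  rw [← ENNReal.ofReal_mul (by positivity), ← ENNReal.ofReal_mul (by positivity),
    ← ENNReal.ofReal_add (by positivity) (by positivity)]
  exact ENNReal.ofReal_le_ofReal (hφ.map_posPart_le ha hb hl hm hlm)

theorem exists_shiftModular_le [IsFiniteMeasure ν] (hφ : IsYoungFunction φ) (hZ : Measurable Z)
    (hL : ∃ a : ℝ, 0 < a ∧ ∫⁻ s, ENNReal.ofReal (φ (|Z s| / a)) ∂ν < ⊤) (hβ : 0 < β) (x : ℝ) :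
    ∃ a : ℝ, 0 < a ∧ shiftModular ν φ Z x a ≤ ENNReal.ofReal β := by
  obtain ⟨a, ha, hfin⟩ := hL
  have h1 : shiftModular ν φ Z x (2 * a) < ⊤ := by
    have : shiftModular ν φ Z x (2 * a) ≤
        ∫⁻ s, (ENNReal.ofReal (φ (|Z s| / a)) + ENNReal.ofReal (φ (|x| / a))) ∂ν := by
      refine lintegral_mono fun s => ?_
      have hz0 : 0 ≤ |Z s| / a := by positivity
      have hx0 : 0 ≤ |x| / a := by positivity
      rw [← ENNReal.ofReal_add (hφ.nonneg _ hz0) (hφ.nonneg _ hx0)]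
      refine ENNReal.ofReal_le_ofReal ?_
      -- Doubling the scale turns the bound `|Z| + |x|` into a mean of `|Z| / a` and `|x| / a`, to
      -- which convexity applies.
      have hle : max (Z s - x) 0 / (2 * a) ≤ (1 / 2 : ℝ) * (|Z s| / a) + (1 / 2) * (|x| / a) := by
        rw [show (1 / 2 : ℝ) * (|Z s| / a) + (1 / 2) * (|x| / a) = (|Z s| + |x|) / (2 * a) by
          field_simp]
        gcongr
        refine max_le ?_ (by positivity)
        linarith [le_abs_self (Z s), neg_abs_le x]
      have hc := hφ.convexOn.2 (mem_Ici.2 hz0) (mem_Ici.2 hx0) (by norm_num : (0 : ℝ) ≤ 1 / 2)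
        (by norm_num : (0 : ℝ) ≤ 1 / 2) (by norm_num)
      have hm := hφ.monotoneOn (mem_Ici.2 (by positivity)) (mem_Ici.2 (by positivity)) hle
      simp only [smul_eq_mul] at hc
      linarith [hφ.nonneg _ hz0, hφ.nonneg _ hx0]
    refine this.trans_lt ?_
    rw [lintegral_add_right _ measurable_const, lintegral_const]
    exact ENNReal.add_lt_top.2 ⟨hfin, ENNReal.mul_lt_top ENNReal.ofReal_lt_top (measure_lt_top _ _)⟩
  set C := (shiftModular ν φ Z x (2 * a)).toReal with hC
  have hC0 : 0 ≤ C := ENNReal.toReal_nonneg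
  -- Since `n ≥ 1`, enlarging the scale by `n` divides the modular by at least `n`, and `C / n ≤ β`.
  set n := 1 + C / β with hn
  have hn1 : 1 ≤ n := by rw [hn]; have : 0 ≤ C / β := by positivity
                         linarith
  have hn0 : 0 < n := by linarith
  refine ⟨n * (2 * a), by positivity, ?_⟩
  have h2 : shiftModular ν φ Z x (n * (2 * a)) ≤
      ENNReal.ofReal n⁻¹ * shiftModular ν φ Z x (2 * a) := by
    unfold shiftModular
    rw [← lintegral_const_mul _ (hφ.measurable_posPart hZ (by positivity)).ennreal_ofReal]
    refine lintegral_mono fun s => ?_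
    rw [← ENNReal.ofReal_mul (by positivity)]
    refine ENNReal.ofReal_le_ofReal ?_
    have := hφ.map_mul_le (c := n⁻¹) (t := max (Z s - x) 0 / (2 * a)) (by positivity)
      (inv_le_one_of_one_le₀ hn1) (by positivity)
    refine le_trans (le_of_eq ?_) this
    congr 1
    field_simp
  refine h2.trans ?_
  rw [← ENNReal.ofReal_toReal h1.ne, ← hC, ← ENNReal.ofReal_mul (by positivity)]
  refine ENNReal.ofReal_le_ofReal ?_
  rw [inv_mul_le_iff₀ hn0, hn]
  have : (1 + C / β) * β = β + C := by field_simp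
  linarith

theorem bddBelow_shiftNorm_set :
    BddBelow {a : ℝ | 0 < a ∧ shiftModular ν φ Z x a ≤ ENNReal.ofReal β} :=
  ⟨0, fun _ h => h.1.le⟩

theorem shiftNorm_nonneg : 0 ≤ shiftNorm ν φ Z β x :=
  Real.sInf_nonneg fun _ h => h.1.le

theorem shiftNorm_le (ha : 0 < a) (h : shiftModular ν φ Z x a ≤ ENNReal.ofReal β) :
    shiftNorm ν φ Z β x ≤ a :=
  csInf_le bddBelow_shiftNorm_set ⟨ha, h⟩

theorem shiftModular_le_of_shiftNorm_lt (hφ : IsYoungFunction φ)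
    (hne : ∃ a : ℝ, 0 < a ∧ shiftModular ν φ Z x a ≤ ENNReal.ofReal β)
    (h : shiftNorm ν φ Z β x < a) : shiftModular ν φ Z x a ≤ ENNReal.ofReal β := by
  obtain ⟨b, hb, hba⟩ := exists_lt_of_csInf_lt hne h
  exact (shiftModular_anti hφ hb.1 hba.le).trans hb.2

theorem convexOn_shiftNorm (hφ : IsYoungFunction φ) (hZ : Measurable Z)
    (hne : ∀ x, ∃ a : ℝ, 0 < a ∧ shiftModular ν φ Z x a ≤ ENNReal.ofReal β) :
    ConvexOn ℝ univ (shiftNorm ν φ Z β) := by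
  refine ⟨convex_univ, fun x _ y _ l m hl hm hlm => ?_⟩
  simp only [smul_eq_mul]
  -- The infimum defining the norm need not be attained, so the scales are taken slightly above it.
  refine le_of_forall_pos_le_add fun ε hε => ?_
  set a := shiftNorm ν φ Z β x + ε with ha
  set b := shiftNorm ν φ Z β y + ε with hb
  have ha0 : 0 < a := by linarith [shiftNorm_nonneg (ν := ν) (φ := φ) (Z := Z) (β := β) (x := x)]
  have hb0 : 0 < b := by linarith [shiftNorm_nonneg (ν := ν) (φ := φ) (Z := Z) (β := β) (x := y)]
  have hD : 0 < l * a + m * b := by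
    rcases hl.eq_or_lt with rfl | hl'
    · have : m = 1 := by linarith
      subst this; simpa using hb0
    · positivity
  have e : l * shiftNorm ν φ Z β x + m * shiftNorm ν φ Z β y + ε = l * a + m * b := by
    rw [ha, hb]; linear_combination (-ε) * hlm
  rw [e]
  refine shiftNorm_le hD ((shiftModular_convex_le hφ hZ ha0 hb0 hl hm hlm).trans ?_)
  calc _ ≤ ENNReal.ofReal (l * a / (l * a + m * b)) * ENNReal.ofReal β +
        ENNReal.ofReal (m * b / (l * a + m * b)) * ENNReal.ofReal β := by
        gcongr
        · exact shiftModular_le_of_shiftNorm_lt hφ (hne x) (by linarith)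
        · exact shiftModular_le_of_shiftNorm_lt hφ (hne y) (by linarith)
    _ = ENNReal.ofReal β := by
        rw [← add_mul, ← ENNReal.ofReal_add (by positivity) (by positivity), ← add_div,
          div_self hD.ne', ENNReal.ofReal_one, one_mul]

theorem tendsto_shiftNorm_add_cocompact [IsProbabilityMeasure ν] (hφ : IsYoungFunction φ)
    (hφ1 : φ 1 = 1) (hZ : Measurable Z) (hβ : 0 < β) (hβ1 : β < 1)
    (hne : ∀ x, ∃ a : ℝ, 0 < a ∧ shiftModular ν φ Z x a ≤ ENNReal.ofReal β) :
    Tendsto (fun x => shiftNorm ν φ Z β x + x) (cocompact ℝ) atTop := by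
  rw [cocompact_eq_atBot_atTop]
  refine Tendsto.sup ?_ (tendsto_atTop_mono (fun x => le_add_of_nonneg_left shiftNorm_nonneg)
    tendsto_id)
  obtain ⟨c, hc0, hc1, hc⟩ := hφ.exists_lt_one hφ1 hβ1
  have hφc : 0 < φ c := hβ.trans hc
  have hN : ∃ N : ℕ, β / φ c < ν.real {s | -(N : ℝ) ≤ Z s} := by
    have hmono : Monotone fun N : ℕ => {s | -(N : ℝ) ≤ Z s} := by
      intro i j hij s hs
      have : (i : ℝ) ≤ j := by exact_mod_cast hij
      simp only [mem_ofPred_eq] at hs ⊢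
      linarith
    have hU : ⋃ N : ℕ, {s | -(N : ℝ) ≤ Z s} = univ := by
      refine eq_univ_of_forall fun s => ?_
      obtain ⟨n, hn⟩ := exists_nat_ge (-(Z s))
      exact mem_iUnion.2 ⟨n, by simp only [mem_ofPred_eq]; linarith⟩
    have ht := tendsto_measure_iUnion_atTop (μ := ν) hmono
    rw [hU, measure_univ] at ht
    have ht' := (ENNReal.tendsto_toReal ENNReal.one_ne_top).comp ht
    have : β / φ c < (1 : ℝ≥0∞).toReal := by
      rw [ENNReal.toReal_one, div_lt_one hφc]; exact hc
    obtain ⟨N, hN⟩ := (ht'.eventually (lt_mem_nhds this)).exists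
    exact ⟨N, hN⟩
  obtain ⟨N, hN⟩ := hN
  -- For a smaller scale `a`, `(Z - x) / a ≥ c` on `{Z ≥ -N}`, so the modular is at least `φ c * ν
  -- {Z ≥ -N} > β`.
  have key : ∀ x, (-N - x) / c ≤ shiftNorm ν φ Z β x := by
    intro x
    refine le_csInf (hne x) fun a ha => ?_
    by_contra! hlt
    have hca : c ≤ (-N - x) / a := by
      rw [lt_div_iff₀ hc0] at hlt
      rw [le_div_iff₀ ha.1]; linarith
    have hmeas : MeasurableSet {s | -(N : ℝ) ≤ Z s} := measurableSet_le measurable_const hZ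
    have h1 : ENNReal.ofReal (φ c) * ν {s | -(N : ℝ) ≤ Z s} ≤ shiftModular ν φ Z x a := by
      rw [← setLIntegral_const]
      refine (setLIntegral_mono' hmeas fun s hs => ?_).trans (setLIntegral_le_lintegral _ _)
      refine ENNReal.ofReal_le_ofReal (hφ.monotoneOn (mem_Ici.2 hc0.le)
        (mem_Ici.2 (div_nonneg (le_max_right _ _) ha.1.le)) (hca.trans ?_))
      have := ha.1
      have hs' : -(N : ℝ) ≤ Z s := hs
      gcongr
      exact le_max_of_le_left (by linarith)
    have h2 := h1.trans ha.2
    rw [← ofReal_measureReal, ← ENNReal.ofReal_mul hφc.le,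
      ENNReal.ofReal_le_ofReal_iff hβ.le] at h2
    rw [div_lt_iff₀ hφc] at hN
    linarith
  refine tendsto_atTop_mono (f := fun x => (1 - 1 / c) * x + -N / c) (fun x => ?_) ?_
  · have := key x
    calc (1 - 1 / c) * x + -N / c = (-N - x) / c + x := by ring
      _ ≤ _ := by linarith
  · refine tendsto_atTop_add_const_right _ _ (Tendsto.const_mul_atBot_of_neg ?_ tendsto_id)
    have := (one_lt_div hc0).2 hc1
    linarith

theorem convexOn_shiftNorm_add (hφ : IsYoungFunction φ) (hZ : Measurable Z)
    (hne : ∀ x, ∃ a : ℝ, 0 < a ∧ shiftModular ν φ Z x a ≤ ENNReal.ofReal β) :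
    ConvexOn ℝ univ (fun x => shiftNorm ν φ Z β x + x) :=
  (convexOn_shiftNorm hφ hZ hne).add (convexOn_id convex_univ)

theorem exists_isMin_shiftNorm_add [IsProbabilityMeasure ν] (hφ : IsYoungFunction φ)
    (hφ1 : φ 1 = 1) (hZ : Measurable Z) (hβ : 0 < β) (hβ1 : β < 1)
    (hne : ∀ x, ∃ a : ℝ, 0 < a ∧ shiftModular ν φ Z x a ≤ ENNReal.ofReal β) :
    ∃ x, ∀ y, shiftNorm ν φ Z β x + x ≤ shiftNorm ν φ Z β y + y := by
  have hc : Continuous fun x => shiftNorm ν φ Z β x + x := by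
    have := (convexOn_shiftNorm_add hφ hZ hne).continuousOn_interior
    rwa [interior_univ, ← continuousOn_univ.symm] at this
  exact hc.exists_forall_le (tendsto_shiftNorm_add_cocompact hφ hφ1 hZ hβ hβ1 hne)

/-! ### Positivity of the norm, the role of `Δ₂`, uniqueness of the minimizer. -/

theorem shiftNorm_pos (hφ : IsYoungFunction φ) (hZ : Measurable Z)
    (hne : ∃ a : ℝ, 0 < a ∧ shiftModular ν φ Z x a ≤ ENNReal.ofReal β)
    (hxy : x < y) (hy : 0 < ν {s | y < Z s}) : 0 < shiftNorm ν φ Z β x := by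
  refine lt_of_le_of_ne shiftNorm_nonneg fun h0 => ?_
  have hall : ∀ a : ℝ, 0 < a → shiftModular ν φ Z x a ≤ ENNReal.ofReal β := fun a ha =>
    shiftModular_le_of_shiftNorm_lt hφ hne (by rwa [← h0])
  have hlow : ∀ a : ℝ, 0 < a →
      ENNReal.ofReal (φ ((y - x) / a)) * ν {s | y < Z s} ≤ ENNReal.ofReal β := by
    intro a ha
    refine le_trans ?_ (hall a ha)
    rw [← setLIntegral_const]
    refine (setLIntegral_mono' (measurableSet_lt measurable_const hZ) fun s hs => ?_).trans
      (setLIntegral_le_lintegral _ _)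
    have hyx : 0 ≤ y - x := by linarith
    refine ENNReal.ofReal_le_ofReal (hφ.monotoneOn (mem_Ici.2 (by positivity))
      (mem_Ici.2 (by positivity)) ?_)
    have hs' : y < Z s := hs
    gcongr
    exact le_max_of_le_left (by linarith)
  -- With `t = 1 / a`, the lower bound blows up as the scale tends to `0`, so arbitrarily small
  -- scales cannot all be admissible.
  have ht : Tendsto (fun t : ℝ => ENNReal.ofReal (φ ((y - x) * t)) * ν {s | y < Z s}) atTop
      (𝓝 (⊤ * ν {s | y < Z s})) := by
    refine ENNReal.Tendsto.mul_const ?_ (Or.inl ENNReal.top_ne_zero)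
    exact ENNReal.tendsto_ofReal_atTop.comp
      (hφ.tendsto_atTop.comp (tendsto_id.const_mul_atTop (sub_pos.2 hxy)))
  rw [ENNReal.top_mul hy.ne'] at ht
  have hle : (⊤ : ℝ≥0∞) ≤ ENNReal.ofReal β := by
    refine le_of_tendsto ht ?_
    filter_upwards [eventually_gt_atTop (0 : ℝ)] with t ht
    have := hlow t⁻¹ (inv_pos.2 ht)
    rwa [div_inv_eq_mul] at this
  exact absurd hle (not_le.2 ENNReal.ofReal_lt_top)

theorem shiftNorm_eq_zero (hφ : IsYoungFunction φ) (h : ∀ᵐ s ∂ν, Z s ≤ x) :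
    shiftNorm ν φ Z β x = 0 := by
  refine le_antisymm (le_of_forall_pos_le_add fun ε hε => ?_) shiftNorm_nonneg
  rw [zero_add]
  refine shiftNorm_le hε ?_
  have : shiftModular ν φ Z x ε = 0 := by
    rw [shiftModular, ← lintegral_zero (μ := ν)]
    refine lintegral_congr_ae ?_
    filter_upwards [h] with s hs
    rw [max_eq_right (sub_nonpos.2 hs), zero_div, hφ.map_zero, ENNReal.ofReal_zero]
  rw [this]
  exact zero_le

/-- Convexity along `(1 + t) p = (1 - t) p + t (2 p)`. Once the modular at `a / 2` is finite, this
is a quantitative continuity of the modular in the scale. -/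
theorem shiftModular_one_add_le (hφ : IsYoungFunction φ) (hZ : Measurable Z) (ha : 0 < a) {t : ℝ}
    (ht : 0 ≤ t) (ht1 : t ≤ 1) :
    shiftModular ν φ Z x (a / (1 + t)) ≤
      shiftModular ν φ Z x a + ENNReal.ofReal t * shiftModular ν φ Z x (a / 2) := by
  unfold shiftModular
  rw [← lintegral_const_mul _ (hφ.measurable_posPart hZ (by positivity)).ennreal_ofReal,
    ← lintegral_add_left (hφ.measurable_posPart hZ ha.le).ennreal_ofReal]
  refine lintegral_mono fun s => ?_
  have h1 : 0 ≤ φ (max (Z s - x) 0 / a) := hφ.nonneg _ (by positivity)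
  have h2 : 0 ≤ φ (max (Z s - x) 0 / (a / 2)) := hφ.nonneg _ (by positivity)
  rw [← ENNReal.ofReal_mul ht, ← ENNReal.ofReal_add h1 (by positivity)]
  refine ENNReal.ofReal_le_ofReal ?_
  have h := hφ.map_one_add_mul_le (p := max (Z s - x) 0 / a) ht ht1 (by positivity)
  rw [show max (Z s - x) 0 / (a / (1 + t)) = (1 + t) * (max (Z s - x) 0 / a) by field_simp,
    show max (Z s - x) 0 / (a / 2) = 2 * (max (Z s - x) 0 / a) by field_simp]
  exact h

/-- Where the argument is at least `s`, `Δ₂` applies; elsewhere `φ (2 * s)` is a bound, integrable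
because `ν` is finite. The constants do not depend on `x` or `a`. -/
theorem exists_shiftModular_half_le [IsProbabilityMeasure ν] (hφ : IsYoungFunction φ)
    (hZ : Measurable Z) (hΔ : SatisfiesDeltaTwo φ) :
    ∃ K C : ℝ, 0 < K ∧ 0 ≤ C ∧ ∀ x a, 0 < a → shiftModular ν φ Z x (a / 2) ≤
      ENNReal.ofReal K * shiftModular ν φ Z x a + ENNReal.ofReal C := by
  obtain ⟨s, K, hs, hK, h⟩ := hΔ
  refine ⟨K, φ (2 * s), hK, hφ.nonneg _ (by positivity), fun x a ha => ?_⟩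
  have e : ENNReal.ofReal (φ (2 * s)) = ∫⁻ _, ENNReal.ofReal (φ (2 * s)) ∂ν := by simp
  unfold shiftModular
  rw [e, ← lintegral_const_mul _ (hφ.measurable_posPart hZ (by positivity)).ennreal_ofReal,
    ← lintegral_add_right _ measurable_const]
  refine lintegral_mono fun u => ?_
  set p := max (Z u - x) 0 / a with hp
  have hp0 : 0 ≤ p := by positivity
  have h1 : 0 ≤ φ p := hφ.nonneg _ hp0
  have h2 : 0 ≤ φ (2 * s) := hφ.nonneg _ (by positivity)
  rw [← ENNReal.ofReal_mul hK.le, ← ENNReal.ofReal_add (by positivity) h2,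
    show max (Z u - x) 0 / (a / 2) = 2 * p by rw [hp]; field_simp]
  refine ENNReal.ofReal_le_ofReal ?_
  rcases le_total s p with hsp | hsp
  · linarith [h p hsp]
  · have := hφ.monotoneOn (mem_Ici.2 (by positivity : 0 ≤ 2 * p))
      (mem_Ici.2 (by positivity : 0 ≤ 2 * s)) (by linarith)
    nlinarith [mul_nonneg hK.le h1]

theorem ENNReal.le_of_forall_le_add_ofReal_mul {p q C : ℝ≥0∞} (hC : C ≠ ⊤)
    (h : ∀ t : ℝ, 0 < t → t ≤ 1 → p ≤ q + ENNReal.ofReal t * C) : p ≤ q := by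
  have ht : Tendsto (fun t : ℝ => q + ENNReal.ofReal t * C) (𝓝[>] 0)
      (𝓝 (q + ENNReal.ofReal 0 * C)) := by
    refine Tendsto.mono_left ?_ nhdsWithin_le_nhds
    exact tendsto_const_nhds.add (ENNReal.Tendsto.mul_const
      (ENNReal.continuous_ofReal.tendsto 0) (Or.inr hC))
  rw [ENNReal.ofReal_zero, zero_mul, add_zero] at ht
  refine ge_of_tendsto ht ?_
  filter_upwards [Ioc_mem_nhdsGT (zero_lt_one (α := ℝ))] with t ht
  exact h t ht.1 ht.2

/-- Under the `Δ₂`-condition the infimum defining the norm is attained. -/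
theorem shiftModular_shiftNorm_le [IsProbabilityMeasure ν] (hφ : IsYoungFunction φ)
    (hZ : Measurable Z) (hΔ : SatisfiesDeltaTwo φ)
    (hne : ∃ a : ℝ, 0 < a ∧ shiftModular ν φ Z x a ≤ ENNReal.ofReal β)
    (hpos : 0 < shiftNorm ν φ Z β x) :
    shiftModular ν φ Z x (shiftNorm ν φ Z β x) ≤ ENNReal.ofReal β := by
  obtain ⟨K, C, hK, hC, h⟩ := exists_shiftModular_half_le (ν := ν) hφ hZ hΔ
  refine ENNReal.le_of_forall_le_add_ofReal_mul
    (C := ENNReal.ofReal K * ENNReal.ofReal β + ENNReal.ofReal C)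
    (ENNReal.add_ne_top.2 ⟨ENNReal.mul_ne_top ENNReal.ofReal_ne_top ENNReal.ofReal_ne_top,
      ENNReal.ofReal_ne_top⟩) fun t ht ht1 => ?_
  set a := shiftNorm ν φ Z β x with ha
  -- The scale `a * (1 + t)` exceeds the norm, hence is admissible, and dividing it by `1 + t`
  -- returns exactly `a`.
  have hb : 0 < a * (1 + t) := by positivity
  have hle : shiftModular ν φ Z x (a * (1 + t)) ≤ ENNReal.ofReal β :=
    shiftModular_le_of_shiftNorm_lt hφ hne (by rw [← ha]; nlinarith)
  have h1 := shiftModular_one_add_le (ν := ν) (x := x) hφ hZ hb ht.le ht1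
  rw [mul_div_cancel_right₀ _ (by positivity)] at h1
  refine h1.trans ?_
  gcongr
  exact (h x _ hb).trans (by gcongr)

/-- Under the `Δ₂`-condition a modular strictly below the level forces a strict inequality for the
norm. -/
theorem shiftNorm_lt [IsProbabilityMeasure ν] (hφ : IsYoungFunction φ) (hZ : Measurable Z)
    (hΔ : SatisfiesDeltaTwo φ) (ha : 0 < a) (h : shiftModular ν φ Z x a < ENNReal.ofReal β) :
    shiftNorm ν φ Z β x < a := by
  obtain ⟨K, C, hK, hC, hh⟩ := exists_shiftModular_half_le (ν := ν) hφ hZ hΔ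
  have hfin : shiftModular ν φ Z x (a / 2) ≠ ⊤ := by
    refine ((hh x a ha).trans_lt ?_).ne
    exact ENNReal.add_lt_top.2 ⟨ENNReal.mul_lt_top ENNReal.ofReal_lt_top h.lt_top,
      ENNReal.ofReal_lt_top⟩
  have : ∃ t : ℝ, 0 < t ∧ t ≤ 1 ∧
      shiftModular ν φ Z x a + ENNReal.ofReal t * shiftModular ν φ Z x (a / 2) <
        ENNReal.ofReal β := by
    by_contra! hcon
    exact absurd (ENNReal.le_of_forall_le_add_ofReal_mul hfin hcon) (not_le.2 h)
  obtain ⟨t, ht, ht1, hlt⟩ := this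
  refine (shiftNorm_le (by positivity)
    ((shiftModular_one_add_le hφ hZ ha ht.le ht1).trans hlt.le)).trans_lt ?_
  exact div_lt_self ha (by linarith)

theorem shiftModular_midpoint_lt (hφ : IsYoungFunction φ) (hs : StrictConvexOn ℝ (Ici 0) φ)
    (hZ : Measurable Z) (ha : 0 < a) (hb : 0 < b)
    (hxa : shiftModular ν φ Z x a ≤ ENNReal.ofReal β)
    (hyb : shiftModular ν φ Z y b ≤ ENNReal.ofReal β)
    (hne : ¬ ∀ᵐ s ∂ν, max (Z s - x) 0 / a = max (Z s - y) 0 / b) :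
    shiftModular ν φ Z (1 / 2 * x + 1 / 2 * y) (1 / 2 * a + 1 / 2 * b) < ENNReal.ofReal β := by
  set D := 1 / 2 * a + 1 / 2 * b with hD
  have hD0 : 0 < D := by positivity
  set p := 1 / 2 * a / D with hp
  set q := 1 / 2 * b / D with hq
  have hp0 : 0 ≤ p := by positivity
  have hq0 : 0 ≤ q := by positivity
  have hpq : p + q = 1 := by rw [hp, hq, ← add_div, ← hD, div_self hD0.ne']
  have hmx := hφ.measurable_posPart (x := x) hZ ha.le
  have hmy := hφ.measurable_posPart (x := y) hZ hb.le
  have h1 : ∀ s, 0 ≤ φ (max (Z s - x) 0 / a) := fun s => hφ.nonneg _ (by positivity)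
  have h2 : ∀ s, 0 ≤ φ (max (Z s - y) 0 / b) := fun s => hφ.nonneg _ (by positivity)
  -- The convex combination dominating the midpoint integrand still has integral at most `β`; the
  -- strict gain comes from the non-null set where the two arguments differ.
  have hint : ∫⁻ s, ENNReal.ofReal (p * φ (max (Z s - x) 0 / a) + q * φ (max (Z s - y) 0 / b)) ∂ν
      ≤ ENNReal.ofReal β := by
    have : ∀ s, ENNReal.ofReal (p * φ (max (Z s - x) 0 / a) + q * φ (max (Z s - y) 0 / b)) =
        ENNReal.ofReal p * ENNReal.ofReal (φ (max (Z s - x) 0 / a)) +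
          ENNReal.ofReal q * ENNReal.ofReal (φ (max (Z s - y) 0 / b)) := by
      intro s
      rw [ENNReal.ofReal_add (mul_nonneg hp0 (h1 s)) (mul_nonneg hq0 (h2 s)),
        ENNReal.ofReal_mul hp0, ENNReal.ofReal_mul hq0]
    simp_rw [this]
    rw [lintegral_add_left (hmx.ennreal_ofReal.const_mul _),
      lintegral_const_mul _ hmx.ennreal_ofReal, lintegral_const_mul _ hmy.ennreal_ofReal]
    calc _ ≤ ENNReal.ofReal p * ENNReal.ofReal β + ENNReal.ofReal q * ENNReal.ofReal β := by
          gcongr <;> assumption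
      _ = _ := by rw [← add_mul, ← ENNReal.ofReal_add hp0 hq0, hpq, ENNReal.ofReal_one, one_mul]
  refine lt_of_lt_of_le ?_ hint
  have hle : ∀ s, φ (max (Z s - (1 / 2 * x + 1 / 2 * y)) 0 / D) ≤
      p * φ (max (Z s - x) 0 / a) + q * φ (max (Z s - y) 0 / b) := fun s =>
    hφ.map_posPart_le ha hb (by norm_num) (by norm_num) (by norm_num)
  have hA : ν {s | max (Z s - x) 0 / a ≠ max (Z s - y) 0 / b} ≠ 0 := fun h => hne h
  refine lintegral_strict_mono_of_ae_le_of_ae_lt_on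
    ((hmx.const_mul p).add (hmy.const_mul q)).ennreal_ofReal.aemeasurable ?_
    (Eventually.of_forall fun s => ENNReal.ofReal_le_ofReal (hle s)) hA
    (Eventually.of_forall fun s hs' => ?_)
  · refine ne_of_lt ((lintegral_mono fun s => ENNReal.ofReal_le_ofReal (hle s)).trans_lt
      (hint.trans_lt ENNReal.ofReal_lt_top))
  · have hlt := hφ.map_posPart_lt hs (z := Z s) (x := x) (y := y) ha hb
      (by norm_num : (0 : ℝ) < 1 / 2) (by norm_num : (0 : ℝ) < 1 / 2) (by norm_num) hs'
    have h0 : 0 ≤ φ (max (Z s - (1 / 2 * x + 1 / 2 * y)) 0 / D) := hφ.nonneg _ (by positivity)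
    exact (ENNReal.ofReal_lt_ofReal_iff (h0.trans_lt hlt)).2 hlt

theorem unique_isMin_shiftNorm_add [IsProbabilityMeasure ν] (hφ : IsYoungFunction φ)
    (hs : StrictConvexOn ℝ (Ici 0) φ) (hΔ : SatisfiesDeltaTwo φ) (hZ : Measurable Z)
    (hne : ∀ x, ∃ a : ℝ, 0 < a ∧ shiftModular ν φ Z x a ≤ ENNReal.ofReal β)
    {M : EReal} (hM : ∀ᵐ s ∂ν, (Z s : EReal) < M)
    (hM' : ∀ x : ℝ, (x : EReal) < M → 0 < ν {s | x < Z s})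
    (hx : ∀ z, shiftNorm ν φ Z β x + x ≤ shiftNorm ν φ Z β z + z)
    (hy : ∀ z, shiftNorm ν φ Z β y + y ≤ shiftNorm ν φ Z β z + z) : x = y := by
  wlog hlt : x < y generalizing x y
  · rcases lt_trichotomy x y with h | h | h
    · exact this hx hy h
    · exact h
    · exact (this hy hx h).symm
  exfalso
  set w := 1 / 2 * x + 1 / 2 * y with hw
  have hxw : x < w := by rw [hw]; linarith
  have hwy : w < y := by rw [hw]; linarith
  have hwmin : shiftNorm ν φ Z β w + w = shiftNorm ν φ Z β x + x := by
    refine le_antisymm ?_ (hx w)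
    have := (convexOn_shiftNorm_add hφ hZ hne).2 (mem_univ x) (mem_univ y)
      (by norm_num : (0 : ℝ) ≤ 1 / 2) (by norm_num : (0 : ℝ) ≤ 1 / 2) (by norm_num)
    simp only [smul_eq_mul, ← hw] at this
    linarith [hy x]
  have hz : ∀ z : ℝ, M ≤ z → shiftNorm ν φ Z β z = 0 := fun z hz =>
    shiftNorm_eq_zero hφ (hM.mono fun s h => EReal.coe_le_coe_iff.1 (h.le.trans hz))
  -- Otherwise the norm vanishes at both `w` and `y`, and minimality at `y` gives `y ≤ w`. The point
  -- `y` itself may lie beyond `M`, which is why `w` replaces it below.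
  have hwM : (w : EReal) < M := by
    by_contra! h
    have h1 := hz w h
    have h2 := hz y (h.trans (EReal.coe_le_coe_iff.2 hwy.le))
    linarith [hy w]
  obtain ⟨v, hwv, hvM⟩ := EReal.lt_iff_exists_real_btwn.1 hwM
  have hwv' : w < v := EReal.coe_lt_coe_iff.1 hwv
  have hpx := shiftNorm_pos hφ hZ (hne x) (hxw.trans hwv') (hM' v hvM)
  have hpw := shiftNorm_pos hφ hZ (hne w) hwv' (hM' v hvM)
  have hmx := shiftModular_shiftNorm_le hφ hZ hΔ (hne x) hpx
  have hmw := shiftModular_shiftNorm_le hφ hZ hΔ (hne w) hpw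
  set a := shiftNorm ν φ Z β x with ha
  set b := shiftNorm ν φ Z β w with hb
  have hab : b < a := by linarith
  have hnae : ¬ ∀ᵐ s ∂ν, max (Z s - x) 0 / a = max (Z s - w) 0 / b := by
    intro hae
    -- The solution of `(z - x) / a = (z - w) / b`, the only value `Z` could take above `w`.
    set z := (a * w - b * x) / (a - b) with hzdef
    have hZz : ∀ᵐ s ∂ν, w < Z s → Z s = z := by
      filter_upwards [hae] with s h hws
      rw [max_eq_left (by linarith), max_eq_left (by linarith), div_eq_div_iff hpx.ne' hpw.ne'] at h
      rw [hzdef, eq_div_iff (by linarith)]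
      linarith
    have hMz : M ≤ z := by
      by_contra! hzM
      have : (((max z w : ℝ)) : EReal) < M := by
        rcases max_choice z w with h | h <;> rw [h] <;> assumption
      have hpos := hM' _ this
      refine hpos.ne' (measure_mono_null (t := {s | ¬ (w < Z s → Z s = z)}) (fun s hs' => ?_) hZz)
      have hs'' : max z w < Z s := hs'
      simp only [mem_ofPred_eq, Classical.not_imp]
      exact ⟨(le_max_right _ _).trans_lt hs'', ((le_max_left _ _).trans_lt hs'').ne'⟩
    refine (hM' w hwM).ne' (measure_mono_null (t := {s | ¬ ((Z s : EReal) < M ∧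
      (w < Z s → Z s = z))}) (fun s hs' => ?_) (hM.and hZz))
    rintro ⟨h1, h2⟩
    rw [h2 hs'] at h1
    exact absurd hMz (not_le.2 h1)
  have hlt' := shiftNorm_lt hφ hZ hΔ (by positivity)
    (shiftModular_midpoint_lt hφ hs hZ hpx hpw hmx hmw hnae)
  have := hx (1 / 2 * x + 1 / 2 * w)
  linarith

end

/-! ### Null endpoints of the distortion measure. -/

section DistortionMeasure

variable (g : DistortionFunction)

theorem DistortionFunction.isProbabilityMeasure_restrict :
    IsProbabilityMeasure (g.measure.restrict (Icc 0 1)) := by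
  refine ⟨?_⟩
  rw [Measure.restrict_apply_univ, g.measure_Icc (right_mem_Icc.2 zero_le_one), g.map_one',
    ENNReal.ofReal_one]

/-- This is where `g u → 1` as `u ↗ 1` enters: it discards the order `1 - u = 0`, at which the
quantile is `-∞`. -/
theorem DistortionFunction.measure_singleton_one : g.measure {1} = 0 := by
  have h1 : Function.leftLim g.stieltjes 1 = 1 := by
    refine leftLim_eq_of_tendsto ?_
    refine g.tendsto_one'.congr' ?_
    filter_upwards [Ico_mem_nhdsLT (zero_lt_one (α := ℝ))] with y hy
    change g y = if y < 0 then 0 else g (min y 1)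
    rw [if_neg (not_lt.2 hy.1), min_eq_left hy.2.le]
  have h2 : g.stieltjes 1 = 1 := by
    change (if (1 : ℝ) < 0 then 0 else g (min 1 1)) = 1
    rw [if_neg (by norm_num), min_self, g.map_one']
  rw [DistortionFunction.measure, StieltjesFunction.measure_singleton, h1, h2, sub_self,
    ENNReal.ofReal_zero]

theorem DistortionFunction.ae_mem_Ico : ∀ᵐ u ∂g.measure.restrict (Icc 0 1), u ∈ Ico (0 : ℝ) 1 := by
  have h1 : ∀ᵐ u ∂g.measure.restrict (Icc 0 1), u ≠ (1 : ℝ) :=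
    ae_restrict_of_ae (measure_eq_zero_iff_ae_notMem.1 g.measure_singleton_one)
  filter_upwards [h1, ae_restrict_mem measurableSet_Icc] with u hu hu'
  exact ⟨hu'.1, lt_of_le_of_ne hu'.2 hu⟩

theorem DistortionFunction.ae_mem_Ioo (h0 : g 0 = 0) :
    ∀ᵐ u ∂g.measure.restrict (Icc 0 1), u ∈ Ioo (0 : ℝ) 1 := by
  have h : g.measure {0} = 0 := by
    rw [← Icc_self, g.measure_Icc (left_mem_Icc.2 zero_le_one), h0, ENNReal.ofReal_zero]
  have h1 : ∀ᵐ u ∂g.measure.restrict (Icc 0 1), u ≠ (0 : ℝ) :=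
    ae_restrict_of_ae (measure_eq_zero_iff_ae_notMem.1 h)
  filter_upwards [h1, g.ae_mem_Ico] with u hu hu'
  exact ⟨lt_of_le_of_ne hu'.1 (Ne.symm hu), hu'.2⟩

end DistortionMeasure

/-! ### Quantiles, and the passage from `X` to `Z`. -/

section Quantile

variable {Ω : Type*} [MeasurableSpace Ω] {P : Measure Ω} {X : Ω → ℝ} {g : DistortionFunction}
  {φ : ℝ → ℝ}

theorem quantile_mono : Monotone (quantile P X) := by
  intro u v huv
  exact sInf_le_sInf (image_mono fun x hx => le_trans huv hx)

theorem measurable_quantile_one_sub : Measurable fun u : ℝ => (quantile P X (1 - u)).toReal := by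
  have : Antitone fun u : ℝ => quantile P X (1 - u) := fun u v huv =>
    quantile_mono (by linarith)
  exact this.measurable.ereal_toReal

theorem quantile_le {v x : ℝ} (h : v ≤ P.real {ω | X ω ≤ x}) : quantile P X v ≤ (x : EReal) :=
  sInf_le ⟨x, h, rfl⟩

theorem youngExt_abs_div {z a : ℝ} (ha : 0 < a) :
    youngExt φ ((z : EReal).abs / ENNReal.ofReal a) = ENNReal.ofReal (φ (|z| / a)) := by
  rw [EReal.abs_def, ← ENNReal.ofReal_div_of_pos ha, youngExt, if_neg ENNReal.ofReal_ne_top,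
    ENNReal.toReal_ofReal (by positivity)]

variable [IsProbabilityMeasure P]

theorem measureReal_setOf_le_mono {x y : ℝ} (h : x ≤ y) :
    P.real {ω | X ω ≤ x} ≤ P.real {ω | X ω ≤ y} :=
  measureReal_mono fun _ hω => le_trans hω h

theorem measureReal_setOf_le_eq_cdf (hX : Measurable X) (x : ℝ) :
    P.real {ω | X ω ≤ x} = ProbabilityTheory.cdf (P.map X) x := by
  have := Measure.isProbabilityMeasure_map (μ := P) hX.aemeasurable
  rw [ProbabilityTheory.cdf_eq_real, map_measureReal_apply hX measurableSet_Iic]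
  rfl

theorem le_quantile {v x : ℝ} (h : P.real {ω | X ω ≤ x} < v) : (x : EReal) ≤ quantile P X v := by
  refine le_sInf ?_
  rintro _ ⟨y, hy, rfl⟩
  refine EReal.coe_le_coe_iff.2 (le_of_not_gt fun hlt => ?_)
  exact absurd (le_trans hy (measureReal_setOf_le_mono hlt.le)) (not_le.2 h)

theorem quantile_ne_bot (hX : Measurable X) {v : ℝ} (hv : 0 < v) : quantile P X v ≠ ⊥ := by
  have := ProbabilityTheory.tendsto_cdf_atBot (P.map X)
  obtain ⟨x, hx⟩ := (this.eventually (gt_mem_nhds hv)).exists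
  rw [← measureReal_setOf_le_eq_cdf hX] at hx
  exact ((EReal.bot_lt_coe x).trans_le (le_quantile hx)).ne'

theorem quantile_ne_top (hX : Measurable X) {v : ℝ} (hv : v < 1) : quantile P X v ≠ ⊤ := by
  have := ProbabilityTheory.tendsto_cdf_atTop (P.map X)
  obtain ⟨x, hx⟩ := (this.eventually (lt_mem_nhds hv)).exists
  rw [← measureReal_setOf_le_eq_cdf hX] at hx
  exact ((quantile_le hx.le).trans_lt (EReal.coe_lt_top x)).ne

/-- Quantiles of positive order commute with `(· - x)⁺`. -/
theorem quantile_posPart {v z : ℝ} (hv : 0 < v) (hz : quantile P X v = z) (x : ℝ) :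
    quantile P (fun ω => max (X ω - x) 0) v = (max (z - x) 0 : ℝ) := by
  have hset : ∀ y : ℝ, 0 ≤ y → {ω | max (X ω - x) 0 ≤ y} = {ω | X ω ≤ y + x} := by
    intro y hy
    ext ω
    simp [hy]
  apply le_antisymm
  · refine EReal.le_of_forall_lt_iff_le.1 fun c hc => ?_
    have hc' : max (z - x) 0 < c := EReal.coe_lt_coe_iff.1 hc
    have hlt : quantile P X v < ((c + x : ℝ) : EReal) := by
      rw [hz, EReal.coe_lt_coe_iff]
      linarith [le_max_left (z - x) 0]
    obtain ⟨_, ⟨y, hy, rfl⟩, hyc⟩ := sInf_lt_iff.1 hlt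
    have hyc' : y < c + x := EReal.coe_lt_coe_iff.1 hyc
    have hc0 : 0 ≤ c := (le_max_right _ _).trans hc'.le
    refine quantile_le ?_
    rw [hset c hc0]
    exact le_trans hy (measureReal_setOf_le_mono hyc'.le)
  · refine le_sInf ?_
    rintro _ ⟨y, hy, rfl⟩
    have hy' : v ≤ P.real {ω | max (X ω - x) 0 ≤ y} := hy
    -- Positivity of the order `v` excludes negative `y`, for which the event is empty.
    have hy0 : 0 ≤ y := by
      by_contra! hneg
      have : {ω | max (X ω - x) 0 ≤ y} = ∅ := by
        refine eq_empty_of_forall_notMem fun ω hω => ?_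
        exact absurd ((le_max_right _ _).trans hω) (not_le.2 hneg)
      rw [this, measureReal_empty] at hy'
      linarith
    rw [hset y hy0] at hy'
    have := quantile_le hy'
    rw [hz, EReal.coe_le_coe_iff] at this
    exact EReal.coe_le_coe_iff.2 (max_le (by linarith) hy0)

/-- Only the order `1`, at `u = 0`, can still give `∞`. In that case `φ ∞ = ∞` and the finite
modular leave no `μ_g`-mass at `0`. -/
theorem ae_quantile_eq_coe (hX : X ∈ orliczLorentzSpace P g φ) :
    ∀ᵐ u ∂g.measure.restrict (Icc 0 1),
      u < 1 ∧ quantile P X (1 - u) = ((quantile P X (1 - u)).toReal : EReal) := by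
  obtain ⟨hXm, a, ha, hfin⟩ := hX
  have h0 : ∀ᵐ u ∂g.measure.restrict (Icc 0 1), u = (0 : ℝ) → quantile P X (1 - u) ≠ ⊤ := by
    by_cases htop : quantile P X 1 = ⊤
    · have hle : (⊤ : ℝ≥0∞) * g.measure {0} ≤ orliczLorentzModular P g φ X a := by
        have : ∫⁻ u in {(0 : ℝ)}, youngExt φ ((quantile P X (1 - u)).abs / ENNReal.ofReal a)
            ∂g.measure = ⊤ * g.measure {0} := by
          rw [lintegral_singleton, sub_zero, htop, EReal.abs_top,
            ENNReal.top_div_of_ne_top ENNReal.ofReal_ne_top, youngExt, if_pos rfl]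
        rw [← this]
        exact lintegral_mono_set (singleton_subset_iff.2 (left_mem_Icc.2 zero_le_one))
      have hz : g.measure {0} = 0 := by
        by_contra hne
        rw [ENNReal.top_mul hne] at hle
        exact absurd hfin (not_lt.2 hle)
      have : ∀ᵐ u ∂g.measure.restrict (Icc 0 1), u ≠ (0 : ℝ) :=
        ae_restrict_of_ae (measure_eq_zero_iff_ae_notMem.1 hz)
      exact this.mono fun u hu h => absurd h hu
    · refine Eventually.of_forall fun u hu => ?_
      rwa [hu, sub_zero]
  filter_upwards [h0, g.ae_mem_Ico] with u hu hu'
  refine ⟨hu'.2, (EReal.coe_toReal ?_ (quantile_ne_bot hXm (by linarith [hu'.2]))).symm⟩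
  rcases hu'.1.eq_or_lt with h | h
  · exact hu h.symm
  · exact quantile_ne_top hXm (by linarith)

theorem orliczLorentzModular_posPart (hX : X ∈ orliczLorentzSpace P g φ) (x : ℝ) {a : ℝ}
    (ha : 0 < a) :
    orliczLorentzModular P g φ (fun ω => max (X ω - x) 0) a =
      shiftModular (g.measure.restrict (Icc 0 1)) φ (fun u => (quantile P X (1 - u)).toReal) x a := by
  refine lintegral_congr_ae ?_
  filter_upwards [ae_quantile_eq_coe hX] with u hu
  rw [quantile_posPart (by linarith [hu.1]) hu.2, youngExt_abs_div ha,
    abs_of_nonneg (le_max_right _ _)]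

theorem shiftedPremium_eq (hX : X ∈ orliczLorentzSpace P g φ) (α x : ℝ) :
    shiftedPremium P g φ α X x = shiftNorm (g.measure.restrict (Icc 0 1)) φ
      (fun u => (quantile P X (1 - u)).toReal) (1 - α) x + x := by
  unfold shiftedPremium orliczLorentzPremium shiftNorm
  congr 2
  ext a
  refine and_congr_right fun ha => ?_
  rw [orliczLorentzModular_posPart hX x ha]

theorem lintegral_quantile_lt_top (hX : X ∈ orliczLorentzSpace P g φ) :
    ∃ a : ℝ, 0 < a ∧ ∫⁻ u, ENNReal.ofReal (φ (|(quantile P X (1 - u)).toReal| / a))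
      ∂g.measure.restrict (Icc 0 1) < ⊤ := by
  obtain ⟨hXm, a, ha, hfin⟩ := id hX
  refine ⟨a, ha, (le_of_eq ?_).trans_lt hfin⟩
  refine lintegral_congr_ae ?_
  filter_upwards [ae_quantile_eq_coe hX] with u hu
  rw [← youngExt_abs_div ha, ← hu.2]

/-- If the quantile were at least `M`, every `c < M` would satisfy `P (X ≤ c) ≤ v`. Letting `c ↗ M`
exhausts `{X < M}`, which has probability `1` as `M` is not an atom, so `1 ≤ v`. -/
theorem quantile_lt_essSup (h : P {ω | (X ω : EReal) = essSupReal P X} = 0) {v : ℝ} (hv : v < 1) :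
    quantile P X v < essSupReal P X := by
  by_contra! hle
  set M := essSupReal P X with hM
  have hlt : ∀ᵐ ω ∂P, (X ω : EReal) < M := by
    have h1 : ∀ᵐ ω ∂P, (X ω : EReal) ≤ M := ae_le_essSup
    have h2 : ∀ᵐ ω ∂P, (X ω : EReal) ≠ M := measure_eq_zero_iff_ae_notMem.1 h
    filter_upwards [h1, h2] with ω ha hb
    exact lt_of_le_of_ne ha hb
  have hbot : ⊥ < M := by
    obtain ⟨ω, hω⟩ := hlt.exists
    exact bot_le.trans_lt hω
  obtain ⟨c, hcm, hc, hct⟩ := exists_seq_strictMono_tendsto' hbot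
  have hF : ∀ n, P {ω | (X ω : EReal) ≤ c n} ≤ ENNReal.ofReal v := by
    intro n
    have hcoe : ((c n).toReal : EReal) = c n :=
      EReal.coe_toReal ((hc n).2.trans_le le_top).ne (hc n).1.ne'
    have hset : {ω | (X ω : EReal) ≤ c n} = {ω | X ω ≤ (c n).toReal} := by
      ext ω
      rw [mem_ofPred_eq, mem_ofPred_eq, ← hcoe, EReal.coe_le_coe_iff, EReal.toReal_coe]
    rw [hset, ← ofReal_measureReal]
    refine ENNReal.ofReal_le_ofReal (le_of_not_ge fun hcon => ?_)
    have := quantile_le hcon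
    rw [hcoe] at this
    exact absurd (hle.trans this) (not_le.2 (hc n).2)
  have hmono : Monotone fun n => {ω | (X ω : EReal) ≤ c n} := fun i j hij ω hω =>
    le_trans (b := c i) hω (hcm.monotone hij)
  have ht := tendsto_measure_iUnion_atTop (μ := P) hmono
  have hU : P (⋃ n, {ω | (X ω : EReal) ≤ c n}) = 1 := by
    rw [← measure_univ (μ := P)]
    refine measure_congr (eventuallyEq_univ.2 ?_)
    filter_upwards [hlt] with ω hω
    obtain ⟨n, hn⟩ := (hct.eventually (lt_mem_nhds hω)).exists
    exact mem_iUnion.2 ⟨n, hn.le⟩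
  rw [hU] at ht
  have h1 : (1 : ℝ≥0∞) ≤ ENNReal.ofReal v := le_of_tendsto ht (Eventually.of_forall hF)
  rw [ENNReal.one_le_ofReal] at h1
  linarith

theorem measure_lt_quantile_pos (hX : Measurable X) (hg : ∀ u ∈ Ioc (0 : ℝ) 1, 0 < g u)
    (h0 : g 0 = 0) {x : ℝ} (hx : (x : EReal) < essSupReal P X) :
    0 < g.measure.restrict (Icc 0 1) {u | x < (quantile P X (1 - u)).toReal} := by
  obtain ⟨y, hxy, hyM⟩ := EReal.lt_iff_exists_real_btwn.1 hx
  have hF : P.real {ω | X ω ≤ y} < 1 := by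
    refine lt_of_le_of_ne measureReal_le_one fun h1 => ?_
    have hae : ∀ᵐ ω ∂P, X ω ≤ y := by
      refine (mem_ae_iff_prob_eq_one (measurableSet_le hX measurable_const)).2 ?_
      rw [← ofReal_measureReal, h1, ENNReal.ofReal_one]
    have : essSupReal P X ≤ y :=
      essSup_le_of_ae_le _ (hae.mono fun ω h => EReal.coe_le_coe_iff.2 h)
    exact absurd this (not_le.2 hyM)
  -- Half of the tail probability, so that `1 - u > P (X ≤ y)` strictly for all `u ≤ ε`; the
  -- quantile of order `1 - u` is then at least `y`.
  set ε := (1 - P.real {ω | X ω ≤ y}) / 2 with hε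
  have hF0 : 0 ≤ P.real {ω | X ω ≤ y} := measureReal_nonneg
  have hε0 : 0 < ε := by rw [hε]; linarith
  have hε1 : ε ≤ 1 := by rw [hε]; linarith
  have hpos : 0 < g.measure.restrict (Icc 0 1) (Icc 0 ε) := by
    rw [Measure.restrict_apply measurableSet_Icc,
      inter_eq_left.2 (Icc_subset_Icc_right hε1), g.measure_Icc ⟨hε0.le, hε1⟩]
    exact ENNReal.ofReal_pos.2 (hg ε ⟨hε0, hε1⟩)
  refine hpos.trans_le (measure_mono_ae ?_)
  filter_upwards [g.ae_mem_Ioo h0] with u hu hu'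
  have huε : u ≤ ε := (mem_Icc.1 hu').2
  have hq : (y : EReal) ≤ quantile P X (1 - u) := le_quantile (by linarith)
  rw [← EReal.coe_toReal (quantile_ne_top hX (by linarith [hu.1]))
    (quantile_ne_bot hX (by linarith [hu.2])), EReal.coe_le_coe_iff] at hq
  exact (EReal.coe_lt_coe_iff.1 hxy).trans_le hq

end Quantile

theorem proposition5 {Ω : Type*} [MeasurableSpace Ω] (P : Measure Ω) [IsProbabilityMeasure P]
    (g : DistortionFunction) (φ : ℝ → ℝ) (hφ : IsYoungFunction φ) (hφ1 : φ 1 = 1)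
    (α : ℝ) (hα0 : 0 < α) (hα1 : α < 1)
    (X : Ω → ℝ) (hX : X ∈ orliczLorentzSpace P g φ) :
    IsLeast (Set.range (shiftedPremium P g φ α X)) (distortionHGRisk P g φ α X) ∧
    (ContinuousOn g (Set.Icc 0 1) → g 0 = 0 → (∀ u ∈ Set.Ioc (0 : ℝ) 1, 0 < g u) →
      StrictConvexOn ℝ (Set.Ici 0) φ → SatisfiesDeltaTwo φ →
      P {ω | (X ω : EReal) = essSupReal P X} = 0 →
      ∃! x : ℝ, distortionHGRisk P g φ α X = shiftedPremium P g φ α X x) := by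
  have := g.isProbabilityMeasure_restrict
  have hXm : Measurable X := hX.1
  have hZ : Measurable fun u : ℝ => (quantile P X (1 - u)).toReal := measurable_quantile_one_sub
  have hβ : 0 < 1 - α := by linarith
  have hne := exists_shiftModular_le hφ hZ (lintegral_quantile_lt_top hX) hβ
  obtain ⟨x, hx⟩ := exists_isMin_shiftNorm_add hφ hφ1 hZ hβ (by linarith) hne
  simp only [← shiftedPremium_eq hX] at hx
  have hbdd : BddBelow (range (shiftedPremium P g φ α X)) :=
    ⟨shiftedPremium P g φ α X x, forall_mem_range.2 hx⟩
  have hmin : distortionHGRisk P g φ α X = shiftedPremium P g φ α X x :=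
    le_antisymm (ciInf_le hbdd x) (le_ciInf hx)
  refine ⟨⟨⟨x, hmin.symm⟩, forall_mem_range.2 fun y => ciInf_le hbdd y⟩, ?_⟩
  intro _ hg0 hg hs hΔ hP
  refine ⟨x, hmin, fun y hy => ?_⟩
  have hM : ∀ᵐ u ∂g.measure.restrict (Icc 0 1),
      ((quantile P X (1 - u)).toReal : EReal) < essSupReal P X := by
    filter_upwards [g.ae_mem_Ioo hg0] with u hu
    rw [EReal.coe_toReal (quantile_ne_top hXm (by linarith [hu.1]))
      (quantile_ne_bot hXm (by linarith [hu.2]))]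
    exact quantile_lt_essSup hP (by linarith [hu.1])
  refine unique_isMin_shiftNorm_add (β := 1 - α) hφ hs hΔ hZ hne hM
    (fun z hz => measure_lt_quantile_pos hXm hg hg0 hz) (fun z => ?_) fun z => ?_
  · rw [← shiftedPremium_eq hX, ← shiftedPremium_eq hX, ← hy, hmin]
    exact hx z
  · rw [← shiftedPremium_eq hX, ← shiftedPremium_eq hX]
    exact hx z
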